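/- Let $\tilde M$ be a connected smooth manifold without boundary (finite dimensional, Hausdorff, second countable), and let $M\subset\tilde M$ be a Whitney subset: $M$ is closed and connected, $M$ is the closure of its interior in $\tilde M$, and there is a continuous linear operator $\mathcal E:\mathcal W(M)\to C^\infty(\tilde M,\mathbb R)$ such that $\mathcal E(F)$ has jet $F(x)$ at every $x\in M$, for every $F\in\mathcal W(M)$. Here $\mathcal W(M)$ is the space of Whitney jets of infinite order on $M$ with its natural Fréchet topology, and $C^\infty(\tilde M,\mathbb R)$ carries the topology of uniform convergence on compact sets in all derivatives separately. (The pair $\tilde M\supset M$ represents a Whitney manifold germ.) Let $\partial M$ be the topological boundary of $M$ in $\tilde M$. Let $\mathfrak X(M)=\{X|_M: X\in\mathfrak X(\tilde M)\}$ be the space of restrictions to $M$ of smooth vector fields on $\tilde M$, with the bracket $[X|_M,Y|_M]=[X,Y]|_M$ (well defined since $M$ is the closure of its interior) and with the Fréchet topology of Whitney jets along $M$, that is, the topology given by the Whitney seminorms in charts over compact subsets of $M$. Let $\mathfrak X_c(M)\subset\mathfrak X(M)$ be the Lie algebra of the fields with compact support, with the inductive limit (LF) topology over the spaces $\mathfrak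 X_K(M)$ of fields with support in $K$, where $K\subset M$ is compact. Let $$\mathfrak X_\partial(M)=\{X|_M: X\in\mathfrak X(\tilde M),\ x\in\partial M\Rightarrow \mathrm{Fl}^X_t(x)\in\partial M\text{ for all } t \text{ for which } \mathrm{Fl}^X_t(x)\text{ exists in }\tilde M\},$$ where $\mathrm{Fl}^X$ is the local flow of $X$ on $\tilde M$, and let $\mathfrak X_{c,\partial}(M)=\mathfrak X_\partial(M)\cap\mathfrak X_c(M)$. Then $\mathfrak X_\partial(M)$ is a closed linear Lie subalgebra of $\mathfrak X(M)$, and $\mathfrak X_{c,\partial}(M)$ is a closed linear Lie subalgebra of $\mathfrak X_c(M)$. -/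

import Mathlib

open scoped Manifold ContDiff Topology
open Set

noncomputable section

namespace WhitneyGerm

/-! ### Whitney fields in a Euclidean space

A field of formal derivatives `p` assigns to a point `z` and an order `k` a `k`-linear form `p z k`,
which plays the role of the collection of all `F^(α)(z)` with `|α| = k`. -/

section Euclidean

variable {E F : Type*} [NormedAddCommGroup E] [NormedSpace ℝ E]
  [NormedAddCommGroup F] [NormedSpace ℝ F]

/-- The Taylor polynomial `z ↦ T_y^n(p)(z)` of order `n` at `y`. -/
def taylorPoly (p : E → FormalMultilinearSeries ℝ E F) (n : ℕ) (y z : E) : F :=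
  ∑ j ∈ Finset.range (n + 1), ((j.factorial : ℝ)⁻¹) • p y j (fun _ => z - y)

/-- The remainder of order `k` : `D^k p (x) - D^k (T_y^n p) (x)`. -/
def remainder (p : E → FormalMultilinearSeries ℝ E F) (n k : ℕ) (x y : E) : E [×k]→L[ℝ] F :=
  p x k - iteratedFDeriv ℝ k (taylorPoly p n y) x

/-- The Whitney conditions on `S` : continuity of every component, and on every compact subset of
`S` the remainders of order `k ≤ n` are `o(‖x - y‖ ^ (n - k))` uniformly as `‖x - y‖ → 0`. -/
def IsWhitneyOn (S : Set E) (p : E → FormalMultilinearSeries ℝ E F) : Prop :=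
  (∀ k, ContinuousOn (fun z => p z k) S) ∧
  ∀ K ⊆ S, IsCompact K → ∀ n k, k ≤ n → ∀ ε > 0, ∃ δ > 0, ∀ x ∈ K, ∀ y ∈ K,
    0 < ‖x - y‖ → ‖x - y‖ ≤ δ → ‖remainder p n k x y‖ ≤ ε * ‖x - y‖ ^ (n - k)

/-- The topology given by the Whitney seminorms over all compact `K ⊆ S` and all orders `n` :
uniform convergence on `K` of all components `p x k`, and uniform convergence on `K × K` of all
remainder quotients `‖x - y‖ ^ (-(n - k)) • remainder p n k x y`, `k ≤ n`. (On the diagonal these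
quotients play no role: there the remainders of the jet of a function vanish.) -/
@[reducible] def whitneyTopology (S : Set E) : TopologicalSpace (E → FormalMultilinearSeries ℝ E F) :=
  (⨅ k : ℕ, TopologicalSpace.induced
    (fun p => UniformOnFun.ofFun {K : Set E | K ⊆ S ∧ IsCompact K} (fun z => p z k))
    inferInstance) ⊓
  (⨅ n : ℕ, ⨅ k : Fin (n + 1), TopologicalSpace.induced
    (fun p => UniformOnFun.ofFun {L : Set (E × E) | ∃ K : Set E, K ⊆ S ∧ IsCompact K ∧ L = K ×ˢ K}
      (fun q => (‖q.1 - q.2‖ ^ (n - (k : ℕ)))⁻¹ • remainder p n k q.1 q.2))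
    inferInstance)

lemma contDiff_taylorPoly (p : E → FormalMultilinearSeries ℝ E F) (n : ℕ) (y : E) :
    ContDiff ℝ ∞ (taylorPoly p n y) := by
  unfold taylorPoly
  refine ContDiff.sum fun j _ => contDiff_const.smul ?_
  exact (p y j).contDiff.comp (contDiff_pi.2 fun _ => contDiff_id.sub contDiff_const)

lemma remainder_add (p q : E → FormalMultilinearSeries ℝ E F) (n k : ℕ) (x y : E) :
    remainder (p + q) n k x y = remainder p n k x y + remainder q n k x y := by
  have h : taylorPoly (p + q) n y = taylorPoly p n y + taylorPoly q n y := by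
    funext z
    simp [taylorPoly, Finset.sum_add_distrib]
  unfold remainder
  rw [h, iteratedFDeriv_add_apply
    ((contDiff_taylorPoly p n y).of_le (mod_cast le_top)).contDiffAt
    ((contDiff_taylorPoly q n y).of_le (mod_cast le_top)).contDiffAt]
  exact add_sub_add_comm _ _ _ _

lemma remainder_smul (c : ℝ) (p : E → FormalMultilinearSeries ℝ E F) (n k : ℕ) (x y : E) :
    remainder (c • p) n k x y = c • remainder p n k x y := by
  have h : taylorPoly (c • p) n y = c • taylorPoly p n y := by
    funext z
    simp [taylorPoly, Finset.smul_sum, smul_comm c]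
  unfold remainder
  rw [h, iteratedFDeriv_const_smul_apply
    ((contDiff_taylorPoly p n y).of_le (mod_cast le_top)).contDiffAt]
  rw [smul_sub]
  rfl

lemma IsWhitneyOn.add {S : Set E} {p q : E → FormalMultilinearSeries ℝ E F}
    (hp : IsWhitneyOn S p) (hq : IsWhitneyOn S q) : IsWhitneyOn S (p + q) := by
  refine ⟨fun k => (hp.1 k).add (hq.1 k), fun K hK hc n k hk ε hε => ?_⟩
  obtain ⟨d₁, hd₁, h₁⟩ := hp.2 K hK hc n k hk (ε / 2) (half_pos hε)
  obtain ⟨d₂, hd₂, h₂⟩ := hq.2 K hK hc n k hk (ε / 2) (half_pos hε)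
  refine ⟨min d₁ d₂, lt_min hd₁ hd₂, fun x hx y hy h0 h => ?_⟩
  rw [remainder_add]
  refine (norm_add_le _ _).trans ?_
  have a := h₁ x hx y hy h0 (h.trans (min_le_left _ _))
  have b := h₂ x hx y hy h0 (h.trans (min_le_right _ _))
  linarith

lemma IsWhitneyOn.smul {S : Set E} {p : E → FormalMultilinearSeries ℝ E F} (c : ℝ)
    (hp : IsWhitneyOn S p) : IsWhitneyOn S (c • p) := by
  refine ⟨fun k => (hp.1 k).const_smul c, fun K hK hc n k hk ε hε => ?_⟩
  have hpos : 0 < ‖c‖ + 1 := by positivity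
  obtain ⟨d, hd, h⟩ := hp.2 K hK hc n k hk (ε / (‖c‖ + 1)) (div_pos hε hpos)
  refine ⟨d, hd, fun x hx y hy h0 hxy => ?_⟩
  rw [remainder_smul, norm_smul]
  calc ‖c‖ * ‖remainder p n k x y‖
      ≤ (‖c‖ + 1) * (ε / (‖c‖ + 1) * ‖x - y‖ ^ (n - k)) :=
        mul_le_mul (by linarith) (h x hx y hy h0 hxy) (norm_nonneg _) hpos.le
    _ = ε * ‖x - y‖ ^ (n - k) := by field_simp

lemma isWhitneyOn_zero (S : Set E) :
    IsWhitneyOn S (0 : E → FormalMultilinearSeries ℝ E F) := by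
  refine ⟨fun k => continuousOn_const, fun K _ _ n k _ ε hε => ⟨1, one_pos, ?_⟩⟩
  intro x _ y _ _ _
  have h : remainder (0 : E → FormalMultilinearSeries ℝ E F) n k x y = 0 := by
    simpa using remainder_smul (0 : ℝ) (0 : E → FormalMultilinearSeries ℝ E F) n k x y
  rw [h, norm_zero]
  positivity

end Euclidean

/-! ### Smooth functions and Whitney jets on a manifold -/

/-- The model space. -/
abbrev Model (m : ℕ) : Type := EuclideanSpace ℝ (Fin m)

section Jets

variable (m : ℕ) (N : Type*) [TopologicalSpace N] [ChartedSpace (Model m) N]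

/-- Smooth real functions on `N`. -/
abbrev SmoothFun : Type _ := C^∞⟮𝓘(ℝ, Model m), N; 𝓘(ℝ, ℝ), ℝ⟯

/-- All charts of the smooth structure of `N`. -/
abbrev Chart : Type _ :=
  {e : OpenPartialHomeomorph N (Model m) // e ∈ IsManifold.maximalAtlas 𝓘(ℝ, Model m) ∞ N}

/-- The topology on `C^∞(N, ℝ)` of uniform convergence on compact sets (of chart domains) of all
derivatives separately. -/
@[reducible] def smoothTopology : TopologicalSpace (SmoothFun m N) :=
  ⨅ (e : Chart m N) (k : ℕ), TopologicalSpace.induced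
    (fun f => UniformOnFun.ofFun {K : Set (Model m) | K ⊆ e.1.target ∧ IsCompact K}
      (iteratedFDeriv ℝ k (fun z => f (e.1.symm z))))
    inferInstance

variable {m N}

lemma contDiffAt_comp_symm [IsManifold 𝓘(ℝ, Model m) ∞ N] (f : SmoothFun m N) (e : Chart m N)
    {z : Model m} (hz : z ∈ e.1.target) : ContDiffAt ℝ ∞ (fun z => f (e.1.symm z)) z := by
  have h := (contMDiffOn_symm_of_mem_maximalAtlas e.2).contMDiffAt (e.1.open_target.mem_nhds hz)
  exact (f.contMDiff.contMDiffAt.comp z h).contDiffAt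

/-- The `k`-th derivative at `x` of a smooth function, in the chart `e` around `x`. -/
def chartDeriv [IsManifold 𝓘(ℝ, Model m) ∞ N] (e : Chart m N) (x : N) (hx : x ∈ e.1.source)
    (k : ℕ) : SmoothFun m N →ₗ[ℝ] (Model m [×k]→L[ℝ] ℝ) where
  toFun f := iteratedFDeriv ℝ k (fun z => f (e.1.symm z)) (e.1 x)
  map_add' f g := by
    have hz := e.1.map_source hx
    exact iteratedFDeriv_add_apply
      ((contDiffAt_comp_symm f e hz).of_le (mod_cast le_top))
      ((contDiffAt_comp_symm g e hz).of_le (mod_cast le_top))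
  map_smul' c f := by
    have hz := e.1.map_source hx
    exact iteratedFDeriv_const_smul_apply
      ((contDiffAt_comp_symm f e hz).of_le (mod_cast le_top))

/-- Smooth functions that are flat at `x` : all derivatives at `x` vanish, in all charts. -/
def flatAt [IsManifold 𝓘(ℝ, Model m) ∞ N] (x : N) : Submodule ℝ (SmoothFun m N) :=
  ⨅ (e : Chart m N) (hx : x ∈ e.1.source) (k : ℕ), LinearMap.ker (chartDeriv e x hx k)

/-- The space `J^∞_x(N, ℝ)` of jets of infinite order at `x`. -/
abbrev JetSpace [IsManifold 𝓘(ℝ, Model m) ∞ N] (x : N) : Type _ := SmoothFun m N ⧸ flatAt x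

/-- The `k`-th derivative of a jet at `x`, in the chart `e` around `x`. -/
def jetCoord [IsManifold 𝓘(ℝ, Model m) ∞ N] (e : Chart m N) (x : N) (hx : x ∈ e.1.source)
    (k : ℕ) : JetSpace (m := m) x →ₗ[ℝ] (Model m [×k]→L[ℝ] ℝ) :=
  (flatAt x).liftQ (chartDeriv e x hx k)
    ((iInf_le _ e).trans ((iInf_le _ hx).trans (iInf_le _ k)))

/-- The part of `M` in the domain of the chart `e`, seen in the chart. -/
def chartImage (M : Set N) (e : Chart m N) : Set (Model m) := e.1.target ∩ e.1.symm ⁻¹' M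

open Classical in
/-- A field of jets along `M`, read in the chart `e` (and extended by zero). -/
def jetSeries [IsManifold 𝓘(ℝ, Model m) ∞ N] (M : Set N) (e : Chart m N)
    (F : ∀ x : M, JetSpace (m := m) (x : N)) : Model m → FormalMultilinearSeries ℝ (Model m) ℝ :=
  fun z k => if h : z ∈ chartImage M e then
    jetCoord e (e.1.symm z) (e.1.map_target h.1) k (F ⟨e.1.symm z, h.2⟩) else 0

lemma jetSeries_add [IsManifold 𝓘(ℝ, Model m) ∞ N] (M : Set N) (e : Chart m N)
    (F G : ∀ x : M, JetSpace (m := m) (x : N)) :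
    jetSeries M e (F + G) = jetSeries M e F + jetSeries M e G := by
  funext z k
  by_cases h : z ∈ chartImage M e
  · simp [jetSeries, h]
  · simp [jetSeries, h]

lemma jetSeries_smul [IsManifold 𝓘(ℝ, Model m) ∞ N] (M : Set N) (e : Chart m N) (c : ℝ)
    (F : ∀ x : M, JetSpace (m := m) (x : N)) :
    jetSeries M e (c • F) = c • jetSeries M e F := by
  funext z k
  by_cases h : z ∈ chartImage M e
  · simp [jetSeries, h]
  · simp [jetSeries, h]

/-- The space `𝒲(M)` of Whitney jets of infinite order on `M` : fields of jets along `M` that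
satisfy the Whitney conditions in every chart. -/
def whitneyJets [IsManifold 𝓘(ℝ, Model m) ∞ N] (M : Set N) :
    Submodule ℝ (∀ x : M, JetSpace (m := m) (x : N)) where
  carrier := {F | ∀ e : Chart m N, IsWhitneyOn (chartImage M e) (jetSeries M e F)}
  add_mem' hF hG e := by
    rw [jetSeries_add]
    exact (hF e).add (hG e)
  zero_mem' e := by
    have h : jetSeries M e (0 : ∀ x : M, JetSpace (m := m) (x : N)) = 0 := by
      simpa using jetSeries_smul M e 0 0
    rw [h]
    exact isWhitneyOn_zero _
  smul_mem' c F hF e := by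
    rw [jetSeries_smul]
    exact (hF e).smul c

/-- The natural Fréchet topology on `𝒲(M)`. -/
@[reducible] def whitneyJetTopology [IsManifold 𝓘(ℝ, Model m) ∞ N] (M : Set N) :
    TopologicalSpace (whitneyJets (m := m) M) :=
  ⨅ e : Chart m N, TopologicalSpace.induced
    (fun F : whitneyJets (m := m) M => jetSeries M e F) (whitneyTopology (chartImage M e))

end Jets

/-! ### Whitney pairs -/

/-- A Whitney subset `M` of a manifold `N` : a closed connected subset that is the closure of its
interior, with a continuous linear extension operator for Whitney jets. -/
structure WhitneyPair (m : ℕ) (N : Type*) [TopologicalSpace N] [ChartedSpace (Model m) N]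
    [IsManifold 𝓘(ℝ, Model m) ∞ N] where
  /-- the underlying subset `M` of `N` -/
  carrier : Set N
  isClosed : IsClosed carrier
  isConnected : IsConnected carrier
  closure_interior : closure (interior carrier) = carrier
  exists_extension : ∃ T : whitneyJets (m := m) carrier →ₗ[ℝ] SmoothFun m N,
    Continuous[whitneyJetTopology carrier, smoothTopology m N] T ∧
    ∀ (F : whitneyJets (m := m) carrier) (x : carrier),
      (Submodule.Quotient.mk (T F) : JetSpace (m := m) (x : N)) = F.1 x

/-! ### Smooth vector fields on a manifold -/

section Fields

variable (m : ℕ) (N : Type*) [TopologicalSpace N] [ChartedSpace (Model m) N]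
  [IsManifold 𝓘(ℝ, Model m) ∞ N]

/-- Smooth vector fields on `N`. -/
abbrev SmoothField : Type _ :=
  Cₛ^∞⟮𝓘(ℝ, Model m); Model m, (TangentSpace 𝓘(ℝ, Model m) : N → Type _)⟯

variable {m N}

lemma SmoothField.mdifferentiableAt (X : SmoothField m N) (x : N) :
    MDifferentiableAt 𝓘(ℝ, Model m) 𝓘(ℝ, Model m).tangent
      (fun y => (X y : TangentBundle 𝓘(ℝ, Model m) N)) x :=
  (X.contMDiff x).mdifferentiableAt (by simp)

lemma two_le_infty : (2 : ℕ∞ω) ≤ ∞ := ENat.LEInfty.out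

/-- The usual Lie bracket of smooth vector fields. -/
instance : Bracket (SmoothField m N) (SmoothField m N) where
  bracket X Y := ⟨VectorField.mlieBracket 𝓘(ℝ, Model m) X Y, by
    have : IsManifold 𝓘(ℝ, Model m) (((⊤ : ℕ∞) : ℕ∞ω) + 1) N := by
      simpa using (inferInstance : IsManifold 𝓘(ℝ, Model m) ∞ N)
    have := IsManifold.of_le (I := 𝓘(ℝ, Model m)) (M := N) (m := minSmoothness ℝ 2) (n := ∞)
      (by rw [minSmoothness_of_isRCLikeNormedField]; exact two_le_infty)
    exact ContDiff.mlieBracket_vectorField (m := ⊤) (n := ⊤) X.contMDiff Y.contMDiff (by simp)⟩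

lemma SmoothField.lie_apply (X Y : SmoothField m N) (x : N) :
    ⁅X, Y⁆ x = VectorField.mlieBracket 𝓘(ℝ, Model m) X Y x := rfl

instance : LieRing (SmoothField m N) where
  add_lie X Y Z := by
    have := IsManifold.of_le (I := 𝓘(ℝ, Model m)) (M := N) (m := 2) (n := ∞) two_le_infty
    ext1 x
    exact VectorField.mlieBracket_add_left (X.mdifferentiableAt x) (Y.mdifferentiableAt x)
  lie_add X Y Z := by
    have := IsManifold.of_le (I := 𝓘(ℝ, Model m)) (M := N) (m := 2) (n := ∞) two_le_infty
    ext1 x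
    exact VectorField.mlieBracket_add_right (Y.mdifferentiableAt x) (Z.mdifferentiableAt x)
  lie_self X := by
    ext1 x
    exact congrFun (VectorField.mlieBracket_self (I := 𝓘(ℝ, Model m)) (V := ⇑X)) x
  leibniz_lie X Y Z := by
    have := IsManifold.of_le (I := 𝓘(ℝ, Model m)) (M := N) (m := minSmoothness ℝ 3) (n := ∞)
      (by rw [minSmoothness_of_isRCLikeNormedField]; exact ENat.LEInfty.out)
    have h2 : minSmoothness ℝ 2 ≤ ∞ := by
      rw [minSmoothness_of_isRCLikeNormedField]
      exact two_le_infty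
    ext1 x
    exact VectorField.leibniz_identity_mlieBracket_apply
      ((X.contMDiff x).of_le h2) ((Y.contMDiff x).of_le h2) ((Z.contMDiff x).of_le h2)

instance : LieAlgebra ℝ (SmoothField m N) where
  lie_smul c X Y := by
    have := IsManifold.of_le (I := 𝓘(ℝ, Model m)) (M := N) (m := 2) (n := ∞) two_le_infty
    ext1 x
    exact VectorField.mlieBracket_const_smul_right (Y.mdifferentiableAt x)

/-- A smooth vector field, read in the chart `e`. -/
def chartField (e : Chart m N) (X : SmoothField m N) (z : Model m) : Model m :=
  mfderiv 𝓘(ℝ, Model m) 𝓘(ℝ, Model m) e.1 (e.1.symm z) (X (e.1.symm z))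

/-- All derivatives of a smooth vector field in the chart `e`. -/
def chartFieldSeries (e : Chart m N) (X : SmoothField m N) :
    Model m → FormalMultilinearSeries ℝ (Model m) (Model m) :=
  fun z k => iteratedFDeriv ℝ k (chartField e X) z

lemma contDiffAt_chartField (e : Chart m N) (X : SmoothField m N) {z : Model m}
    (hz : z ∈ e.1.target) : ContDiffAt ℝ ∞ (chartField e X) z := by
  have hx : e.1.symm z ∈ e.1.source := e.1.map_target hz
  have h1 : ContMDiffAt 𝓘(ℝ, Model m) 𝓘(ℝ, Model m) ∞ e.1.symm z :=
    (contMDiffOn_symm_of_mem_maximalAtlas e.2).contMDiffAt (e.1.open_target.mem_nhds hz)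
  have h2 := (contMDiffOn_of_mem_maximalAtlas e.2).contMDiffOn_tangentMapWithin (m := ∞)
    (by simp) e.1.open_source.uniqueMDiffOn
  have hp : ⟨e.1.symm z, X (e.1.symm z)⟩ ∈
      (Bundle.TotalSpace.proj ⁻¹' e.1.source : Set (TangentBundle 𝓘(ℝ, Model m) N)) := hx
  have ho : IsOpen (Bundle.TotalSpace.proj ⁻¹' e.1.source :
      Set (TangentBundle 𝓘(ℝ, Model m) N)) :=
    e.1.open_source.preimage (FiberBundle.continuous_proj (Model m) _)
  have h3 := h2.contMDiffAt (ho.mem_nhds hp)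
  have h4 := (contMDiff_snd_tangentBundle_modelSpace (n := ∞) (Model m)
    𝓘(ℝ, Model m)).contMDiffAt.comp _ (h3.comp z ((X.contMDiff (e.1.symm z)).comp z h1))
  refine h4.contDiffAt.congr_of_eventuallyEq ?_
  filter_upwards [e.1.open_target.mem_nhds hz] with w hw
  simp only [chartField, tangentMapWithin, Function.comp]
  rw [mfderivWithin_of_isOpen e.1.open_source (e.1.map_target hw)]

/-- The derivatives of a smooth field at the points of `M` depend only on its restriction to `M`,
if `M` is the closure of its interior. -/
lemma chartFieldSeries_congr {M : Set N} (hM : closure (interior M) = M) {X Y : SmoothField m N}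
    (h : ∀ x ∈ M, X x = Y x) (e : Chart m N) {z : Model m} (hz : z ∈ chartImage M e) :
    chartFieldSeries e X z = chartFieldSeries e Y z := by
  funext k
  have hc (Z : SmoothField m N) :
      ContinuousOn (iteratedFDeriv ℝ k (chartField e Z)) e.1.target := by
    intro w hw
    exact ((contDiffAt_chartField e Z hw).continuousAt_iteratedFDeriv
      (mod_cast le_top)).continuousWithinAt
  have hU : IsOpen (e.1.target ∩ e.1.symm ⁻¹' interior M) :=
    e.1.isOpen_inter_preimage_symm isOpen_interior
  have hEq : EqOn (iteratedFDeriv ℝ k (chartField e X)) (iteratedFDeriv ℝ k (chartField e Y))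
      (e.1.target ∩ e.1.symm ⁻¹' interior M) := by
    intro w hw
    refine (Filter.EventuallyEq.iteratedFDeriv ℝ ?_ k).eq_of_nhds
    filter_upwards [hU.mem_nhds hw] with v hv
    simp only [chartField]
    rw [h _ (interior_subset hv.2)]
  have hcl : z ∈ closure (e.1.target ∩ e.1.symm ⁻¹' interior M) := by
    have hx : e.1.symm z ∈ closure (interior M) := by rw [hM]; exact hz.2
    rw [mem_closure_iff_nhds] at hx ⊢
    intro V hV
    obtain ⟨y, hy, hyM⟩ := hx (e.1.source ∩ e.1 ⁻¹' V) (Filter.inter_mem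
      (e.1.open_source.mem_nhds (e.1.map_target hz.1))
      ((e.1.continuousAt (e.1.map_target hz.1)).preimage_mem_nhds
        (by rw [e.1.right_inv hz.1]; exact hV)))
    exact ⟨e.1 y, hy.2, e.1.map_source hy.1, by simpa [e.1.left_inv hy.1] using hyM⟩
  exact hEq.of_subset_closure (hc X |>.mono inter_subset_left) (hc Y |>.mono inter_subset_left)
    (t := e.1.target ∩ closure (e.1.target ∩ e.1.symm ⁻¹' interior M))
    (fun w hw => ⟨hw.1, subset_closure hw⟩) inter_subset_right ⟨hz.1, hcl⟩

/-- The flow of `X` preserves the set `B` : for `x ∈ B` we have `Fl_t^X(x) ∈ B` for all `t` for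
which `Fl_t^X(x)` exists, i.e. the integral curve of `X` through `x`, on any open
interval around `0` on which it exists, stays in `B`. -/
def FlowPreserves (X : SmoothField m N) (B : Set N) : Prop :=
  ∀ x ∈ B, ∀ (γ : ℝ → N) (a b : ℝ), a < 0 → 0 < b → γ 0 = x →
    IsMIntegralCurveOn (I := 𝓘(ℝ, Model m)) γ X (Ioo a b) → ∀ t ∈ Ioo a b, γ t ∈ B

/-- Restriction of vector fields on `N` to sections over `M` of the tangent bundle of `N`. -/
def restrictField (M : Set N) :
    SmoothField m N →ₗ[ℝ] (∀ x : M, TangentSpace 𝓘(ℝ, Model m) (x : N)) where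
  toFun X := fun x => X x
  map_add' _ _ := rfl
  map_smul' _ _ := rfl

lemma isClosed_zeros (X : SmoothField m N) : IsClosed {x : N | X x = 0} := by
  rw [← isOpen_compl_iff, isOpen_iff_mem_nhds]
  intro x hx
  have hx : X x ≠ 0 := hx
  let t := trivializationAt (Model m) (TangentSpace 𝓘(ℝ, Model m) : N → Type _) x
  have hb : x ∈ t.baseSet := FiberBundle.mem_baseSet_trivializationAt' x
  have hc := ((Bundle.contMDiffAt_section (F := Model m)
    (E := (TangentSpace 𝓘(ℝ, Model m) : N → Type _)) (s := X) x).1 (X.contMDiff x)).continuousAt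
  have h0 : (t ⟨x, X x⟩).2 ≠ 0 := by
    intro h
    apply hx
    have := (t.linearEquivAt ℝ x hb).map_eq_zero_iff (x := X x)
    exact this.1 h
  filter_upwards [hc.eventually_ne h0, t.open_baseSet.mem_nhds hb] with y hy hyb h
  apply hy
  have h : X y = 0 := h
  have := (t.linearEquivAt ℝ y hyb).map_zero
  rw [← h] at this
  exact this

/-- The bracket is local on a set which is the closure of its interior. -/
lemma lie_eq_zero_of_eq_zero {M O : Set N} (hM : closure (interior M) = M) (hO : IsOpen O)
    (X Y : SmoothField m N) (h : ∀ x ∈ M ∩ O, X x = 0) : ∀ x ∈ M ∩ O, ⁅X, Y⁆ x = 0 := by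
  intro x hx
  have key : interior M ∩ O ⊆ {x : N | ⁅X, Y⁆ x = 0} := by
    intro y hy
    have he : (X : ∀ x : N, TangentSpace 𝓘(ℝ, Model m) x) =ᶠ[𝓝 y] 0 := by
      filter_upwards [(isOpen_interior.inter hO).mem_nhds hy] with z hz
      exact h z ⟨interior_subset hz.1, hz.2⟩
    have h2 := he.mlieBracket_vectorField_eq
      (Filter.EventuallyEq.refl (𝓝 y) (Y : ∀ x : N, TangentSpace 𝓘(ℝ, Model m) x))
    change VectorField.mlieBracket 𝓘(ℝ, Model m) X Y y = 0
    rw [h2]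
    exact congrFun VectorField.mlieBracket_zero_left y
  have hxc : x ∈ closure (interior M ∩ O) := by
    rw [inter_comm]
    exact hO.inter_closure ⟨hx.2, by rw [hM]; exact hx.1⟩
  exact (isClosed_zeros ⁅X, Y⁆).closure_subset_iff.2 key hxc

end Fields

/-! ### Vector fields on a Whitney pair -/

namespace WhitneyPair

variable {m : ℕ} {N : Type*} [TopologicalSpace N] [ChartedSpace (Model m) N]
  [IsManifold 𝓘(ℝ, Model m) ∞ N] (M : WhitneyPair m N)

/-- The space `𝔛(M)` of restrictions to `M` of smooth vector fields on `N`. -/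
def fields : Submodule ℝ (∀ x : M.carrier, TangentSpace 𝓘(ℝ, Model m) (x : N)) :=
  LinearMap.range (restrictField M.carrier)

/-- The restriction `X ↦ X|_M`. -/
def restrict : SmoothField m N →ₗ[ℝ] M.fields := (restrictField M.carrier).rangeRestrict

variable {M} in
/-- Some smooth extension to `N` of a vector field on `M`. -/
def extend (X : M.fields) : SmoothField m N := X.2.choose

variable {M} in
@[simp] lemma restrict_extend (X : M.fields) : M.restrict (extend X) = X :=
  Subtype.ext X.2.choose_spec

lemma restrict_eq_zero_iff (X : SmoothField m N) :
    M.restrict X = 0 ↔ ∀ x ∈ M.carrier, X x = 0 := by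
  constructor
  · intro h x hx
    exact congrFun (congrArg Subtype.val h) ⟨x, hx⟩
  · intro h
    exact Subtype.ext (funext fun x => h x x.2)

lemma restrict_lie_congr {X X' Y Y' : SmoothField m N} (hX : M.restrict X = M.restrict X')
    (hY : M.restrict Y = M.restrict Y') : M.restrict ⁅X, Y⁆ = M.restrict ⁅X', Y'⁆ := by
  have h (U V : SmoothField m N) (hU : M.restrict U = 0) : M.restrict ⁅U, V⁆ = 0 := by
    rw [restrict_eq_zero_iff] at hU ⊢
    intro x hx
    exact lie_eq_zero_of_eq_zero M.closure_interior isOpen_univ U V (fun y hy => hU y hy.1) x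
      ⟨hx, mem_univ x⟩
  have h1 := h (X - X') Y (by rw [map_sub, hX, sub_self])
  have h2 := h (Y - Y') X' (by rw [map_sub, hY, sub_self])
  rw [sub_lie, map_sub, sub_eq_zero] at h1
  rw [sub_lie, map_sub, sub_eq_zero] at h2
  rw [h1, ← lie_skew, ← lie_skew X', map_neg, map_neg, h2]

/-- The bracket of `𝔛(M)` : the restriction of the bracket of smooth extensions. -/
instance : Bracket M.fields M.fields where
  bracket X Y := M.restrict ⁅extend X, extend Y⁆

/-- The bracket on `𝔛(M)` does not depend on the chosen extensions. -/
lemma restrict_lie (X Y : SmoothField m N) :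
    M.restrict ⁅X, Y⁆ = ⁅M.restrict X, M.restrict Y⁆ :=
  M.restrict_lie_congr (restrict_extend _).symm (restrict_extend _).symm

lemma restrict_surjective : Function.Surjective M.restrict := fun X => ⟨_, restrict_extend X⟩

instance : LieRing M.fields where
  add_lie X Y Z := by
    obtain ⟨X, rfl⟩ := M.restrict_surjective X
    obtain ⟨Y, rfl⟩ := M.restrict_surjective Y
    obtain ⟨Z, rfl⟩ := M.restrict_surjective Z
    simp only [← map_add, ← restrict_lie, add_lie]
  lie_add X Y Z := by
    obtain ⟨X, rfl⟩ := M.restrict_surjective X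
    obtain ⟨Y, rfl⟩ := M.restrict_surjective Y
    obtain ⟨Z, rfl⟩ := M.restrict_surjective Z
    simp only [← map_add, ← restrict_lie, lie_add]
  lie_self X := by
    obtain ⟨X, rfl⟩ := M.restrict_surjective X
    rw [← restrict_lie, lie_self, map_zero]
  leibniz_lie X Y Z := by
    obtain ⟨X, rfl⟩ := M.restrict_surjective X
    obtain ⟨Y, rfl⟩ := M.restrict_surjective Y
    obtain ⟨Z, rfl⟩ := M.restrict_surjective Z
    simp only [← restrict_lie, ← map_add]
    rw [← leibniz_lie]

instance : LieAlgebra ℝ M.fields where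
  lie_smul c X Y := by
    obtain ⟨X, rfl⟩ := M.restrict_surjective X
    obtain ⟨Y, rfl⟩ := M.restrict_surjective Y
    simp only [← map_smul, ← restrict_lie, lie_smul]

/-- The Fréchet topology on `𝔛(M)` : the topology of the Whitney jets along `M`, given in the
charts by the derivatives at the points of `M` of a smooth extension. As `M` is the closure of its
interior, these derivatives do not depend on the extension. -/
@[reducible] def fieldTopology : TopologicalSpace M.fields :=
  ⨅ e : Chart m N, TopologicalSpace.induced (fun X : M.fields => chartFieldSeries e (extend X))
    (whitneyTopology (chartImage M.carrier e))

/-- The support of a vector field on `M`. -/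
def supp (X : M.fields) : Set N := closure {x : N | ∃ h : x ∈ M.carrier, X.1 ⟨x, h⟩ ≠ 0}

lemma supp_subset_iff (X : M.fields) {C : Set N} (hC : IsClosed C) :
    M.supp X ⊆ C ↔ ∀ x (h : x ∈ M.carrier), x ∉ C → X.1 ⟨x, h⟩ = 0 := by
  unfold supp
  rw [hC.closure_subset_iff]
  constructor
  · intro h x hx hxC
    by_contra h0
    exact hxC (h ⟨hx, h0⟩)
  · rintro h x ⟨hx, h0⟩
    by_contra hxC
    exact h0 (h x hx hxC)

lemma eq_zero_of_notMem_supp (X : M.fields) {x : N} (hx : x ∈ M.carrier) (h : x ∉ M.supp X) :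
    X.1 ⟨x, hx⟩ = 0 :=
  (M.supp_subset_iff X isClosed_closure).1 subset_rfl x hx h

/-- The Lie algebra `𝔛_c(M)` of vector fields on `M` with compact support. -/
def compactFields : LieSubalgebra ℝ M.fields where
  carrier := {X | IsCompact (M.supp X)}
  add_mem' {X Y} hX hY := by
    have hC : IsClosed (M.supp X ∪ M.supp Y) := isClosed_closure.union isClosed_closure
    refine (hX.union hY).of_isClosed_subset isClosed_closure
      ((M.supp_subset_iff _ hC).2 fun x hx h => ?_)
    rw [mem_union, not_or] at h
    change X.1 ⟨x, hx⟩ + Y.1 ⟨x, hx⟩ = 0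
    rw [M.eq_zero_of_notMem_supp X hx h.1, M.eq_zero_of_notMem_supp Y hx h.2, add_zero]
  zero_mem' := by
    have h : M.supp 0 ⊆ ∅ := (M.supp_subset_iff 0 isClosed_empty).2 fun x hx _ => rfl
    change IsCompact (M.supp 0)
    rw [subset_empty_iff.1 h]
    exact isCompact_empty
  smul_mem' c X hX := by
    refine hX.of_isClosed_subset isClosed_closure
      ((M.supp_subset_iff _ isClosed_closure).2 fun x hx h => ?_)
    change c • X.1 ⟨x, hx⟩ = 0
    rw [M.eq_zero_of_notMem_supp X hx h, smul_zero]
  lie_mem' {X Y} hX _ := by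
    refine hX.of_isClosed_subset isClosed_closure
      ((M.supp_subset_iff _ isClosed_closure).2 fun x hx h => ?_)
    refine lie_eq_zero_of_eq_zero M.closure_interior (O := (M.supp X)ᶜ)
      isClosed_closure.isOpen_compl (extend X) (extend Y) (fun y hy => ?_) x ⟨hx, h⟩
    have h1 : (extend X) y = X.1 ⟨y, hy.1⟩ :=
      congrFun (congrArg Subtype.val (restrict_extend X)) ⟨y, hy.1⟩
    rw [h1]
    exact M.eq_zero_of_notMem_supp X hy.1 hy.2

/-- The inductive limit (LF) topology on `𝔛_c(M)` : the finest locally convex vector space topology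
for which, for every compact `K ⊆ M`, the inclusion of the space `𝔛_K(M)` of fields with
support in `K` (with the topology induced from `𝔛(M)`) is continuous. -/
@[reducible] def compactFieldTopology : TopologicalSpace M.compactFields :=
  sInf {t | @IsTopologicalAddGroup M.compactFields t _ ∧
    @ContinuousSMul ℝ M.compactFields _ _ t ∧
    @LocallyConvexSpace ℝ M.compactFields _ _ _ _ t ∧
    ∀ K : Set N, K ⊆ M.carrier → IsCompact K →
      Continuous[TopologicalSpace.induced
          (fun X : {X : M.compactFields // M.supp X.1 ⊆ K} => X.1.1) M.fieldTopology, t]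
        (fun X : {X : M.compactFields // M.supp X.1 ⊆ K} => X.1)}

/-- The boundary of `M` : its topological boundary in `N`. -/
def boundary : Set N := frontier M.carrier

/-- The space `𝔛_∂(M)` of the restrictions to `M` of the smooth vector fields on `N` whose
flow preserves the boundary of `M`. -/
def boundaryFields : Set M.fields :=
  {Y | ∃ X : SmoothField m N, M.restrict X = Y ∧ FlowPreserves X M.boundary}

/-- The space `𝔛_{c,∂}(M)` of the fields in `𝔛_∂(M)` with compact support. -/
def compactBoundaryFields : Set M.compactFields := {Y | (Y : M.fields) ∈ M.boundaryFields}

end WhitneyPair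

end WhitneyGerm

end

open scoped Manifold ContDiff Topology

/-!
Read in charts, a closed set `B` is preserved by the flow of a smooth vector field `X` if and only
if both `X` and `-X` point into `B` along `B` in the sense of contingent directions. One direction
is immediate from the flow, the other is Nagumo's theorem, proved with Grönwall's inequality for
the distance to `B`. Composing the flows of `X` and `Y` gives curves in `B` with expansions
`z + t (X + Y) + o(t)` and, for the commutator of the flows, `z + t² [X, Y] + o(t²)`, so that the
fields preserving `B` form a Lie algebra. For each point of `B` the tangency condition is closed
in the value of the field at this point, and evaluation is continuous in the topology of Whitney
jets, hence also in the inductive limit topology.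
-/

noncomputable section

namespace WhitneyGerm

section TangentCone

open Filter Metric

lemma isClosed_tangentConeAt (R : Type*) {E : Type*} [AddCommGroup E] [SMul R E]
    [TopologicalSpace E] (S : Set E) (z : E) : IsClosed (tangentConeAt R S z) := by
  simp only [tangentConeAt_def]
  exact isClosed_setOfPred_clusterPt

variable {E : Type*} [NormedAddCommGroup E] [NormedSpace ℝ E] {S : Set E} {z v w : E}

lemma frequently_infDist_add_smul_lt (hv : v ∈ posTangentConeAt S z) {ε : ℝ} (hε : 0 < ε) :
    ∃ᶠ h : ℝ in 𝓝[>] 0, infDist (z + h • v) S < ε * h := by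
  rcases eq_or_ne v 0 with rfl | hv0
  · refine Eventually.frequently ?_
    filter_upwards [self_mem_nhdsWithin] with h (hh : 0 < h)
    rw [smul_zero, add_zero,
      infDist_zero_of_mem_closure (mem_closure_of_nonempty_tangentConeAt ⟨0, hv⟩)]
    positivity
  obtain ⟨ι, l, _, c, d, hd, hmem, hlim⟩ := exists_fun_of_mem_tangentConeAt hv
  have hne : ∀ᶠ n in l, (c n : ℝ) ≠ 0 ∧ d n ≠ 0 := by
    filter_upwards [hlim.eventually_ne hv0] with n hn
    exact ⟨fun h => hn (by rw [NNReal.smul_def, h, zero_smul]), right_ne_zero_of_smul hn⟩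
  have hinv : Tendsto (fun n => ((c n)⁻¹ : ℝ)) l (𝓝[>] 0) := by
    refine tendsto_nhdsWithin_iff.2 ⟨?_, hne.mono fun n hn =>
      inv_pos.2 ((c n).coe_nonneg.lt_of_ne' hn.1)⟩
    have hquot := hd.norm.div hlim.norm (norm_ne_zero_iff.2 hv0)
    rw [norm_zero, zero_div] at hquot
    refine hquot.congr' (hne.mono fun n ⟨hc, hdn⟩ => ?_)
    rw [Pi.div_apply, NNReal.smul_def, norm_smul, Real.norm_of_nonneg (c n).coe_nonneg]
    have := norm_ne_zero_iff.2 hdn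
    field_simp
  refine hinv.frequently (Eventually.frequently ?_)
  filter_upwards [hmem, hne, hinv.eventually self_mem_nhdsWithin,
    hlim (ball_mem_nhds v hε)] with n hn hcd (hpos : 0 < (c n : ℝ)⁻¹) hball
  have hscale : z + (c n : ℝ)⁻¹ • v - (z + d n) = (c n : ℝ)⁻¹ • (v - c n • d n) := by
    rw [NNReal.smul_def, smul_sub, inv_smul_smul₀ hcd.1]
    abel
  calc infDist (z + (c n : ℝ)⁻¹ • v) S ≤ dist (z + (c n : ℝ)⁻¹ • v) (z + d n) :=
        infDist_le_dist_of_mem hn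
    _ = dist v (c n • d n) * (c n : ℝ)⁻¹ := by
        rw [dist_eq_norm, hscale, norm_smul, Real.norm_of_nonneg hpos.le, mul_comm, dist_eq_norm]
    _ < ε * (c n : ℝ)⁻¹ := by gcongr; exact mem_ball'.1 hball

lemma frequently_slope_infDist_lt {α : ℝ → E} {t ρ : ℝ} (hα : HasDerivWithinAt α v (Ici t) t)
    (hz : infDist (α t) S = dist (α t) z) (hw : w ∈ posTangentConeAt S z) (hvw : ‖v - w‖ < ρ) :
    ∃ᶠ s in 𝓝[>] t, (s - t)⁻¹ * (infDist (α s) S - infDist (α t) S) < ρ := by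
  set ε := (ρ - ‖v - w‖) / 2 with hε
  have hε0 : 0 < ε := half_pos (sub_pos.2 hvw)
  have hslope : ∀ᶠ s in 𝓝[>] t, ‖α s - α t - (s - t) • v‖ ≤ ε * ‖s - t‖ :=
    ((hasDerivWithinAt_iff_isLittleO.1 hα).def hε0).filter_mono
      (nhdsWithin_mono t Ioi_subset_Ici_self)
  have hshift : Tendsto (fun h : ℝ => t + h) (𝓝[>] 0) (𝓝[>] t) := by
    refine tendsto_nhdsWithin_iff.2 ⟨?_, ?_⟩
    · exact ((continuous_const.add continuous_id).tendsto' 0 t (add_zero t)).mono_left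
        nhdsWithin_le_nhds
    · filter_upwards [self_mem_nhdsWithin] with h (hh : 0 < h) using lt_add_of_pos_right t hh
  refine hshift.frequently (((frequently_infDist_add_smul_lt hw hε0).and_eventually
    ((hshift.eventually hslope).and self_mem_nhdsWithin)).mono ?_)
  rintro h ⟨hcone, hlin, hpos : 0 < h⟩
  rw [add_sub_cancel_left, Real.norm_of_nonneg hpos.le] at hlin
  have hsplit : α (t + h) - (z + h • w) =
      (α (t + h) - α t - h • v) + (α t - z) + h • (v - w) := by module
  rw [add_sub_cancel_left, inv_mul_lt_iff₀ hpos, sub_lt_iff_lt_add]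
  calc infDist (α (t + h)) S
      ≤ infDist (z + h • w) S + dist (α (t + h)) (z + h • w) := infDist_le_infDist_add_dist
    _ ≤ infDist (z + h • w) S + (ε * h + infDist (α t) S + h * ‖v - w‖) := by
        rw [dist_eq_norm, hsplit, hz, dist_eq_norm]
        have := norm_smul_of_nonneg hpos.le (v - w)
        gcongr
        exact norm_add₃_le.trans (by gcongr; exact this.le)
    _ < ε * h + (ε * h + infDist (α t) S + h * ‖v - w‖) := by gcongr
    _ = h * ρ + infDist (α t) S := by rw [hε]; ring

/-- The contingent directions `v` of `S` at `z` such that the whole line spanned by `v` consists of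
contingent directions. -/
def tangentLines (S : Set E) (z : E) : Set E :=
  {v | ∀ c : ℝ, c • v ∈ posTangentConeAt S z}

lemma isClosed_tangentLines (S : Set E) (z : E) : IsClosed (tangentLines S z) := by
  simp only [tangentLines, ofPred_forall]
  exact isClosed_iInter fun c => (isClosed_tangentConeAt _ S z).preimage (continuous_const_smul c)

lemma zero_mem_tangentLines (hz : z ∈ S) : (0 : E) ∈ tangentLines S z := fun c => by
  rw [smul_zero]
  exact zero_mem_tangentConeAt (subset_closure hz)

lemma smul_mem_tangentLines (c : ℝ) (hv : v ∈ tangentLines S z) : c • v ∈ tangentLines S z :=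
  fun a => by simpa only [smul_smul] using hv (a * c)

lemma mem_posTangentConeAt_of_mem_tangentLines (hv : v ∈ tangentLines S z) :
    v ∈ posTangentConeAt S z := by
  simpa only [one_smul] using hv 1

end TangentCone

section Nagumo

open Filter Metric

variable {E : Type*} [NormedAddCommGroup E] [NormedSpace ℝ E]
  {f : E → E} {K : NNReal} {V : Set E} {α : ℝ → E} {a b : ℝ}

theorem mapsTo_Icc_of_forall_mem_posTangentConeAt {C : Set E} (hC : IsCompact C) (hCV : C ⊆ V)
    (hf : LipschitzOnWith K f V) (hα : IsIntegralCurveOn α (fun _ => f) (Icc a b))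
    (hαV : MapsTo α (Icc a b) V) (ha : α a ∈ C)
    (htan : ∀ t ∈ Ico a b, ∀ p ∈ C, infDist (α t) C = dist (α t) p → f p ∈ posTangentConeAt C p) :
    MapsTo α (Icc a b) C := by
  have hslope : ∀ t ∈ Ico a b, ∀ ρ, K * infDist (α t) C < ρ →
      ∃ᶠ s in 𝓝[>] t, (s - t)⁻¹ * (infDist (α s) C - infDist (α t) C) < ρ := by
    intro t ht ρ hρ
    obtain ⟨p, hpC, hp⟩ := hC.exists_infDist_eq_dist ⟨α a, ha⟩ (α t)
    refine frequently_slope_infDist_lt ((hα t (Ico_subset_Icc_self ht)).mono_of_mem_nhdsWithin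
      (Icc_mem_nhdsGE_of_mem ht)) hp (htan t ht p hpC hp) (lt_of_le_of_lt ?_ hρ)
    rw [hp, ← dist_eq_norm]
    exact hf.dist_le_mul _ (hαV (Ico_subset_Icc_self ht)) _ (hCV hpC)
  have hcont : ContinuousOn (fun t => infDist (α t) C) (Icc a b) :=
    (continuous_infDist_pt C).comp_continuousOn hα.continuousOn
  intro t ht
  have hle := le_gronwallBound_of_liminf_deriv_right_le (δ := 0) (K := K) (ε := 0) hcont hslope
    (infDist_zero_of_mem ha).le (fun t _ => (add_zero _).ge) t ht
  rw [gronwallBound_ε0_δ0] at hle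
  exact (hC.isClosed.mem_iff_infDist_zero ⟨α a, ha⟩).2 (le_antisymm hle infDist_nonneg)

/-- Nagumo's theorem. -/
theorem eventually_mem_of_forall_mem_posTangentConeAt [ProperSpace E] {S : Set E} {z : E}
    (hS : IsLocallyClosed S) (hz : z ∈ S) (hV : V ∈ 𝓝 z) (hf : LipschitzOnWith K f V)
    (htan : ∀ p ∈ S ∩ V, f p ∈ posTangentConeAt S p) (hab : a < b)
    (hα : IsIntegralCurveOn α (fun _ => f) (Icc a b)) (ha : α a = z) :
    ∀ᶠ t in 𝓝[>] a, α t ∈ S := by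
  obtain ⟨U, Z, hU, hZ, rfl⟩ := hS
  obtain ⟨r, hr, hrUV⟩ := nhds_basis_closedBall.mem_iff.1 (inter_mem (hU.mem_nhds hz.1) hV)
  have hcont : ContinuousWithinAt α (Ici a) a :=
    ((hα a (left_mem_Icc.2 hab.le)).mono_of_mem_nhdsWithin (Icc_mem_nhdsGE hab)).continuousWithinAt
  have hnear : ∀ᶠ t in 𝓝[≥] a, α t ∈ ball z (r / 2) ∧ t ≤ b :=
    (hcont.eventually (ha ▸ ball_mem_nhds z (half_pos hr))).and
      (mem_of_superset (Icc_mem_nhdsGE hab) fun _ ht => ht.2)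
  obtain ⟨c, hac, hc⟩ := mem_nhdsGE_iff_exists_Icc_subset.1 hnear
  set C := closedBall z r ∩ Z with hC
  have hCS : C = (U ∩ Z) ∩ closedBall z r := by
    rw [hC, inter_assoc, inter_comm Z, ← inter_assoc,
      inter_eq_right.2 (hrUV.trans inter_subset_left)]
  have hmem : MapsTo α (Icc a c) C := by
    refine mapsTo_Icc_of_forall_mem_posTangentConeAt ((isCompact_closedBall z r).inter_right hZ)
      (inter_subset_left.trans (hrUV.trans inter_subset_right)) hf
      (hα.mono (Icc_subset_Icc_right (hc (right_mem_Icc.2 (mem_Ioi.1 hac).le)).2))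
      (fun t ht => (hrUV ?_).2) (ha ▸ ⟨mem_closedBall_self hr.le, hz.2⟩) ?_
    · exact ball_subset_closedBall (ball_subset_ball (half_le_self hr.le) (hc ht).1)
    · intro t ht p hp hdist
      have hpS : p ∈ U ∩ Z := (hCS ▸ hp).1
      have hle : dist (α t) p ≤ dist (α t) z :=
        hdist ▸ infDist_le_dist_of_mem ⟨mem_closedBall_self hr.le, hz.2⟩
      have hpr : dist p z < r := by
        have htri := dist_triangle_left p z (α t)
        have hball := mem_ball.1 (hc (Ico_subset_Icc_self ht)).1
        linarith
      rw [hCS, posTangentConeAt, tangentConeAt_inter_nhds (closedBall_mem_nhds_of_mem hpr)]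
      exact htan p ⟨hpS, (hrUV hp.1).2⟩
  filter_upwards [Ioc_mem_nhdsGT (mem_Ioi.1 hac)] with t ht
  exact (hCS ▸ hmem (Ioc_subset_Icc_self ht)).1

end Nagumo

section Flow

open Filter Asymptotics Metric

variable {E : Type*} [NormedAddCommGroup E] [NormedSpace ℝ E]

lemma norm_sub_taylor_two_le {γ γ' γ'' : ℝ → E} {g : E} {t ε : ℝ}
    (hγ : ∀ s ∈ uIcc 0 t, HasDerivWithinAt γ (γ' s) (uIcc 0 t) s)
    (hγ' : ∀ s ∈ uIcc 0 t, HasDerivWithinAt γ' (γ'' s) (uIcc 0 t) s)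
    (hg : ∀ s ∈ uIcc 0 t, ‖γ'' s - g‖ ≤ ε) :
    ‖γ t - (γ 0 + t • γ' 0 + (t ^ 2 / 2) • g)‖ ≤ ε * t ^ 2 := by
  have hε : 0 ≤ ε := (norm_nonneg _).trans (hg 0 left_mem_uIcc)
  have hvelocity : ∀ s ∈ uIcc 0 t, ‖γ' s - (γ' 0 + s • g)‖ ≤ ε * |t| := by
    intro s hs
    have hmean := (convex_uIcc 0 t).norm_image_sub_le_of_norm_hasDerivWithin_le
      (fun u hu => (hγ' u hu).sub ((hasDerivWithinAt_id u _).smul_const g))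
      (fun u hu => by simpa only [one_smul] using hg u hu) left_mem_uIcc hs
    simp only [Pi.sub_apply, id_eq, zero_smul, sub_zero, Real.norm_eq_abs] at hmean
    have hst : |s| ≤ |t| := by simpa only [sub_zero] using abs_sub_left_of_mem_uIcc hs
    rw [← sub_sub, sub_right_comm]
    exact hmean.trans (mul_le_mul_of_nonneg_left hst hε)
  have hmean := (convex_uIcc 0 t).norm_image_sub_le_of_norm_hasDerivWithin_le
    (f := fun s => γ s - (γ 0 + s • γ' 0 + (s ^ 2 / 2) • g))
    (f' := fun s => γ' s - (γ' 0 + s • g)) (fun u hu => (hγ u hu).sub ?_)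
    hvelocity left_mem_uIcc right_mem_uIcc
  · simpa [mul_assoc, ← sq] using hmean
  · have hsq := (((hasDerivWithinAt_id u _).pow 2).div_const 2).smul_const (s := uIcc 0 t) g
    simpa using (((hasDerivWithinAt_id u _).smul_const (γ' 0)).const_add (γ 0)).fun_add hsq

/-- `Φ` is a local flow of the vector field `f` near `z` and time `0`. The domain is kept implicit:
all conditions are required near `z`, respectively `(z, 0)`, only. -/
structure IsLocalFlowAt (Φ : E × ℝ → E) (f : E → E) (z : E) : Prop where
  tendsto : Tendsto Φ (𝓝 (z, 0)) (𝓝 z)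
  map_zero : ∀ᶠ x in 𝓝 z, Φ (x, 0) = x
  hasDerivAt : ∀ᶠ q in 𝓝 (z, (0 : ℝ)), HasDerivAt (fun s => Φ (q.1, s)) (f (Φ q)) q.2

variable {Φ : E × ℝ → E} {f : E → E} {z : E}

lemma exists_isLocalFlowAt [CompleteSpace E] (hf : ContDiffAt ℝ 1 f z) :
    ∃ Φ, IsLocalFlowAt Φ f z := by
  obtain ⟨ε, hε, a, r, L, K, hr, hPL⟩ := IsPicardLindelof.of_contDiffAt_one hf
  obtain ⟨Φ, hΦ, hcont⟩ :=
    (hPL 0).exists_forall_mem_closedBall_eq_hasDerivWithinAt_continuousOn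
  simp only [zero_sub, zero_add] at hΦ hcont
  have hdomain : closedBall z r ×ˢ Icc (-ε) ε ∈ 𝓝 (z, (0 : ℝ)) :=
    prod_mem_nhds (closedBall_mem_nhds z hr) (Icc_mem_nhds (neg_neg_of_pos hε) hε)
  refine ⟨Φ, ?_, ?_, ?_⟩
  · have hlim : Tendsto Φ (𝓝 (z, 0)) (𝓝 (Φ (z, 0))) := hcont.continuousAt hdomain
    rwa [(hΦ z (mem_closedBall_self r.coe_nonneg)).1] at hlim
  · filter_upwards [closedBall_mem_nhds z hr] with x hx using (hΦ x hx).1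
  · filter_upwards [prod_mem_nhds (closedBall_mem_nhds z hr)
      (Ioo_mem_nhds (neg_neg_of_pos hε) hε)] with q ⟨hx, ht⟩
    exact ((hΦ q.1 hx).2 q.2 (Ioo_subset_Icc_self ht)).hasDerivAt (Icc_mem_nhds ht.1 ht.2)

lemma IsLocalFlowAt.exists_forall_mem_ball (hΦ : IsLocalFlowAt Φ f z) {P : E → Prop}
    (hP : ∀ᶠ w in 𝓝 z, P w) :
    ∃ δ > 0, ∀ x ∈ ball z δ, Φ (x, 0) = x ∧
      ∀ t ∈ Ioo (-δ) δ, HasDerivAt (fun s => Φ (x, s)) (f (Φ (x, t))) t ∧ P (Φ (x, t)) := by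
  obtain ⟨δ₁, hδ₁, hzero⟩ := eventually_nhds_iff_ball.1 hΦ.map_zero
  obtain ⟨δ₂, hδ₂, hderiv⟩ :=
    eventually_nhds_iff_ball.1 (hΦ.hasDerivAt.and (hΦ.tendsto.eventually hP))
  refine ⟨min δ₁ δ₂, lt_min hδ₁ hδ₂, fun x hx =>
    ⟨hzero x (ball_subset_ball (min_le_left _ _) hx), fun t ht => hderiv (x, t) ?_⟩⟩
  rw [← ball_prod_same]
  refine ⟨ball_subset_ball (min_le_right _ _) hx, ?_⟩
  rw [mem_ball, Real.dist_0_eq_abs]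
  exact (abs_lt.2 ht).trans_le (min_le_right _ _)

/-- The error term is uniform in the initial point. -/
lemma IsLocalFlowAt.isLittleO (hΦ : IsLocalFlowAt Φ f z) (hf : ContDiffAt ℝ 1 f z) :
    (fun q : E × ℝ => Φ q - (q.1 + q.2 • f q.1 + (q.2 ^ 2 / 2) • fderiv ℝ f z (f z)))
      =o[𝓝 (z, 0)] fun q => q.2 ^ 2 := by
  refine isLittleO_iff.2 fun ε hε => ?_
  have hcont : ContinuousAt (fun w => fderiv ℝ f w (f w)) z :=
    ((hf.fderiv_right (m := 0) le_rfl).continuousAt).clm_apply hf.continuousAt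
  have hdiff : ∀ᶠ w in 𝓝 z, DifferentiableAt ℝ f w :=
    (hf.eventually (by simp)).mono fun w hw => hw.differentiableAt one_ne_zero
  have hclose : ∀ᶠ w in 𝓝 z, ‖fderiv ℝ f w (f w) - fderiv ℝ f z (f z)‖ ≤ ε :=
    (hcont.eventually (closedBall_mem_nhds _ hε)).mono fun w hw => mem_closedBall_iff_norm.1 hw
  obtain ⟨δ, hδ, hflow⟩ := hΦ.exists_forall_mem_ball (hdiff.and hclose)
  filter_upwards [prod_mem_nhds (ball_mem_nhds z hδ) (Ioo_mem_nhds (neg_neg_of_pos hδ) hδ)]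
    with ⟨x, t⟩ ⟨hx, ht⟩
  obtain ⟨hzero, hcurve⟩ := hflow x hx
  have hsub : uIcc 0 t ⊆ Ioo (-δ) δ := ordConnected_Ioo.uIcc_subset ⟨neg_neg_of_pos hδ, hδ⟩ ht
  have htaylor := norm_sub_taylor_two_le (γ := fun s => Φ (x, s)) (γ' := fun s => f (Φ (x, s)))
    (γ'' := fun s => fderiv ℝ f (Φ (x, s)) (f (Φ (x, s))))
    (fun s hs => (hcurve s (hsub hs)).1.hasDerivWithinAt)
    (fun s hs => ((hcurve s (hsub hs)).2.1.hasFDerivAt.comp_hasDerivAt s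
      (hcurve s (hsub hs)).1).hasDerivWithinAt)
    (fun s hs => (hcurve s (hsub hs)).2.2)
  simpa only [hzero, norm_pow, Real.norm_eq_abs, sq_abs] using htaylor

end Flow

section SecondOrder

open Filter Asymptotics

variable {E : Type*} [NormedAddCommGroup E] [NormedSpace ℝ E] {q : ℝ → E} {f g : E → E}
  {S : Set E} {z a b v : E}

lemma mem_posTangentConeAt_of_isLittleO
    (hq : (fun t => q t - (z + t • v)) =o[𝓝[>] 0] fun t : ℝ => t)
    (hqS : ∀ᶠ t in 𝓝[>] 0, q t ∈ S) : v ∈ posTangentConeAt S z := by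
  have hid : Tendsto (fun t : ℝ => t) (𝓝[>] 0) (𝓝 0) := tendsto_id.mono_left nhdsWithin_le_nhds
  refine mem_tangentConeAt_of_seq (𝓝[>] 0) (fun t : ℝ => t⁻¹.toNNReal) (fun t => q t - z) ?_
    (by simpa using hqS) ?_
  · have hlim := (hq.trans_tendsto hid).add (hid.smul_const v)
    rw [zero_smul, add_zero] at hlim
    refine hlim.congr fun t => ?_
    abel
  · have hlim := hq.tendsto_inv_smul_nhds_zero.add_const v
    rw [zero_add] at hlim
    refine hlim.congr' ?_
    filter_upwards [self_mem_nhdsWithin] with t (ht : 0 < t)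
    rw [NNReal.smul_def, Real.coe_toNNReal _ (inv_nonneg.2 ht.le), ← sub_sub, smul_sub,
      inv_smul_smul₀ ht.ne', sub_add_cancel]

/-- The curve `q` satisfies `q t = z + t a + t² b + o(t²)` as `t → 0+`; in particular, `b` is
*half* of the second derivative. -/
def HasSecondOrderExpansion (q : ℝ → E) (z a b : E) : Prop :=
  (fun t => q t - (z + t • a + t ^ 2 • b)) =o[𝓝[>] 0] fun t : ℝ => t ^ 2

lemma isBigO_smul_const {ι : Type*} (u : ι → ℝ) (v : E) (l : Filter ι) :
    (fun i => u i • v) =O[l] u :=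
  .of_bound ‖v‖ (.of_forall fun i => by rw [norm_smul, mul_comm])

lemma HasSecondOrderExpansion.isLittleO (h : HasSecondOrderExpansion q z a b) :
    (fun t => q t - (z + t • a)) =o[𝓝[>] 0] fun t : ℝ => t := by
  have hsq : (fun t : ℝ => t ^ 2) =o[𝓝[>] 0] fun t => t :=
    (isLittleO_pow_id one_lt_two).mono nhdsWithin_le_nhds
  refine ((IsLittleO.isBigO h).add (isBigO_smul_const _ b _) |>.trans_isLittleO hsq).congr_left
    fun t => ?_
  abel

lemma HasSecondOrderExpansion.isBigO (h : HasSecondOrderExpansion q z a b) :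
    (fun t => q t - z) =O[𝓝[>] 0] fun t : ℝ => t := by
  refine (h.isLittleO.isBigO.add (isBigO_smul_const _ a _)).congr_left fun t => ?_
  abel

lemma HasSecondOrderExpansion.tendsto (h : HasSecondOrderExpansion q z a b) :
    Tendsto q (𝓝[>] 0) (𝓝 z) :=
  tendsto_sub_nhds_zero_iff.1 (h.isBigO.trans_tendsto (tendsto_id.mono_left nhdsWithin_le_nhds))

lemma HasSecondOrderExpansion.tendsto_prodMk (h : HasSecondOrderExpansion q z a b) (c : ℝ) :
    Tendsto (fun t => (q t, c * t)) (𝓝[>] 0) (𝓝 (z, 0)) :=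
  h.tendsto.prodMk_nhds
    (((continuous_const_mul c).tendsto' 0 0 (mul_zero c)).mono_left nhdsWithin_le_nhds)

lemma HasSecondOrderExpansion.isLittleO_comp (h : HasSecondOrderExpansion q z a b) {A : E →L[ℝ] E}
    (hf : HasFDerivAt f A z) :
    (fun t => f (q t) - f z - t • A a) =o[𝓝[>] 0] fun t : ℝ => t := by
  refine (((hf.isLittleO.comp_tendsto h.tendsto).trans_isBigO h.isBigO).add
    ((A.isBigO_comp _ _).trans_isLittleO h.isLittleO)).congr_left fun t => ?_
  simp only [Function.comp, map_sub, map_add, map_smul]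
  abel

lemma HasSecondOrderExpansion.flow {Φ : E × ℝ → E} (h : HasSecondOrderExpansion q z a b)
    (hΦ : IsLocalFlowAt Φ f z) (hf : ContDiffAt ℝ 1 f z) (c : ℝ) :
    HasSecondOrderExpansion (fun t => Φ (q t, c * t)) z (a + c • f z)
      (b + c • fderiv ℝ f z a + (c ^ 2 / 2) • fderiv ℝ f z (f z)) := by
  have hct : (fun t : ℝ => c * t) =O[𝓝[>] 0] fun t => t := (isBigO_refl _ _).const_mul_left c
  have hflow := ((hΦ.isLittleO hf).comp_tendsto (h.tendsto_prodMk c)).trans_isBigO (hct.pow 2)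
  have hvelocity : (fun t : ℝ => (c * t) • (f (q t) - f z - t • fderiv ℝ f z a)) =o[𝓝[>] 0]
      fun t : ℝ => t ^ 2 := by
    simpa only [smul_eq_mul, ← sq] using hct.smul_isLittleO
      (h.isLittleO_comp (hf.differentiableAt one_ne_zero).hasFDerivAt)
  refine ((hflow.add h).add hvelocity).congr_left fun t => ?_
  simp only [Function.comp]
  module

/-- Some curve `z + t a + t² b + o(t²)`, `t → 0+`, runs in `S`. -/
def IsSecondOrderTangent (S : Set E) (z a b : E) : Prop :=
  ∃ q, HasSecondOrderExpansion q z a b ∧ ∀ᶠ t in 𝓝[>] 0, q t ∈ S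

lemma isSecondOrderTangent_zero (hz : z ∈ S) : IsSecondOrderTangent S z 0 0 :=
  ⟨fun _ => z, by simp [HasSecondOrderExpansion], .of_forall fun _ => hz⟩

lemma IsSecondOrderTangent.mem_posTangentConeAt (h : IsSecondOrderTangent S z a b) :
    a ∈ posTangentConeAt S z := by
  obtain ⟨q, hq, hqS⟩ := h
  exact mem_posTangentConeAt_of_isLittleO hq.isLittleO hqS

lemma IsSecondOrderTangent.mem_posTangentConeAt_of_zero (h : IsSecondOrderTangent S z 0 b) :
    b ∈ posTangentConeAt S z := by
  obtain ⟨q, hq, hqS⟩ := h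
  have hsqrt : Tendsto Real.sqrt (𝓝[>] 0) (𝓝[>] 0) := by
    refine tendsto_nhdsWithin_iff.2 ⟨?_, ?_⟩
    · exact (Real.continuous_sqrt.tendsto' 0 0 Real.sqrt_zero).mono_left nhdsWithin_le_nhds
    · filter_upwards [self_mem_nhdsWithin] with s hs using Real.sqrt_pos.2 hs
  refine mem_posTangentConeAt_of_isLittleO (q := fun t => q √t) ?_ (hsqrt.eventually hqS)
  have hsq : (fun t => √t ^ 2) =ᶠ[𝓝[>] 0] fun t => t := by
    filter_upwards [self_mem_nhdsWithin] with t ht using Real.sq_sqrt (mem_Ioi.1 ht).le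
  refine (hq.comp_tendsto hsqrt).congr' (hsq.mono fun t ht => ?_) hsq
  simp only [Function.comp, ht, smul_zero, add_zero]

/-- `S` is invariant under some local flow of `f` near `z`. -/
def IsLocallyInvariant (S : Set E) (f : E → E) (z : E) : Prop :=
  ∃ Φ, IsLocalFlowAt Φ f z ∧ ∀ᶠ p in 𝓝 (z, (0 : ℝ)), p.1 ∈ S → Φ p ∈ S

lemma IsSecondOrderTangent.flow (h : IsSecondOrderTangent S z a b) (hf : ContDiffAt ℝ 1 f z)
    (hS : IsLocallyInvariant S f z) (c : ℝ) :
    IsSecondOrderTangent S z (a + c • f z)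
      (b + c • fderiv ℝ f z a + (c ^ 2 / 2) • fderiv ℝ f z (f z)) := by
  obtain ⟨q, hq, hqS⟩ := h
  obtain ⟨Φ, hΦ, hinv⟩ := hS
  refine ⟨fun t => Φ (q t, c * t), hq.flow hΦ hf c, ?_⟩
  filter_upwards [hqS, (hq.tendsto_prodMk c).eventually hinv] with t ht hstay using hstay ht

lemma IsLocallyInvariant.mem_tangentLines (hz : z ∈ S) (hf : ContDiffAt ℝ 1 f z)
    (hfS : IsLocallyInvariant S f z) : f z ∈ tangentLines S z := fun c => by
  simpa using ((isSecondOrderTangent_zero hz).flow hf hfS c).mem_posTangentConeAt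

lemma IsLocallyInvariant.add_mem_tangentLines (hz : z ∈ S) (hf : ContDiffAt ℝ 1 f z)
    (hg : ContDiffAt ℝ 1 g z) (hfS : IsLocallyInvariant S f z) (hgS : IsLocallyInvariant S g z) :
    f z + g z ∈ tangentLines S z := fun c => by
  have hcurve := ((isSecondOrderTangent_zero hz).flow hf hfS c).flow hg hgS c
  simpa using hcurve.mem_posTangentConeAt

/-- The curve `Fl^g_{-t} ∘ Fl^f_{-ct} ∘ Fl^g_t ∘ Fl^f_{ct}` starting at `z` has vanishing velocity
and second-order term `c [f, g] z`. -/
lemma IsLocallyInvariant.lieBracket_mem_tangentLines (hz : z ∈ S) (hf : ContDiffAt ℝ 1 f z)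
    (hg : ContDiffAt ℝ 1 g z) (hfS : IsLocallyInvariant S f z) (hgS : IsLocallyInvariant S g z) :
    VectorField.lieBracket ℝ f g z ∈ tangentLines S z := fun c => by
  have hcurve := ((((isSecondOrderTangent_zero hz).flow hf hfS c).flow hg hgS 1).flow
    hf hfS (-c)).flow hg hgS (-1)
  refine IsSecondOrderTangent.mem_posTangentConeAt_of_zero ?_
  convert hcurve using 1
  · module
  · rw [VectorField.lieBracket_eq]
    simp only [map_add, map_smul, map_zero]
    module

end SecondOrder

section Tangency

open Filter

variable {m : ℕ} {N : Type*} [TopologicalSpace N] [ChartedSpace (Model m) N]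

lemma Chart.mdifferentiable (e : Chart m N) :
    e.1.MDifferentiable 𝓘(ℝ, Model m) 𝓘(ℝ, Model m) :=
  ⟨(contMDiffOn_of_mem_maximalAtlas e.2).mdifferentiableOn (by simp),
    (contMDiffOn_symm_of_mem_maximalAtlas e.2).mdifferentiableOn (by simp)⟩

lemma isLocallyClosed_chartImage {B : Set N} (hB : IsClosed B) (e : Chart m N) :
    IsLocallyClosed (chartImage B e) := by
  refine ⟨e.1.target, (e.1.target ∩ e.1.symm ⁻¹' Bᶜ)ᶜ, e.1.open_target,
    (e.1.isOpen_inter_preimage_symm hB.isOpen_compl).isClosed_compl, ?_⟩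
  ext z
  simp only [chartImage, mem_inter_iff, mem_preimage, mem_compl_iff, not_and, not_not]
  tauto

lemma apply_mem_chartImage_iff {B : Set N} {e : Chart m N} {x : N} (hx : x ∈ e.1.source) :
    e.1 x ∈ chartImage B e ↔ x ∈ B := by
  simp only [chartImage, mem_inter_iff, mem_preimage, e.1.left_inv hx, e.1.map_source hx,
    true_and]

variable [IsManifold 𝓘(ℝ, Model m) ∞ N]

lemma chartField_zero (e : Chart m N) (z : Model m) :
    chartField e (0 : SmoothField m N) z = 0 :=
  map_zero (mfderiv 𝓘(ℝ, Model m) 𝓘(ℝ, Model m) e.1 (e.1.symm z))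

lemma chartField_add (e : Chart m N) (X Y : SmoothField m N) (z : Model m) :
    chartField e (X + Y) z = chartField e X z + chartField e Y z :=
  map_add (mfderiv 𝓘(ℝ, Model m) 𝓘(ℝ, Model m) e.1 (e.1.symm z)) _ _

lemma chartField_smul (e : Chart m N) (c : ℝ) (X : SmoothField m N) (z : Model m) :
    chartField e (c • X) z = c • chartField e X z :=
  map_smul (mfderiv 𝓘(ℝ, Model m) 𝓘(ℝ, Model m) e.1 (e.1.symm z)) _ _

lemma contDiffAt_one_chartField (e : Chart m N) (X : SmoothField m N) {z : Model m}
    (hz : z ∈ e.1.target) : ContDiffAt ℝ 1 (chartField e X) z :=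
  (contDiffAt_chartField e X hz).of_le (mod_cast le_top)

lemma mfderiv_symm_chartField (e : Chart m N) (X : SmoothField m N) {z : Model m}
    (hz : z ∈ e.1.target) :
    mfderiv 𝓘(ℝ, Model m) 𝓘(ℝ, Model m) e.1.symm z (chartField e X z) = X (e.1.symm z) := by
  have hinv := e.mdifferentiable.symm_comp_deriv (e.1.map_target hz)
  rw [e.1.right_inv hz] at hinv
  exact DFunLike.congr_fun hinv (X (e.1.symm z))

lemma mpullback_symm_eq_chartField (e : Chart m N) (X : SmoothField m N) {z : Model m}
    (hz : z ∈ e.1.target) :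
    VectorField.mpullback 𝓘(ℝ, Model m) 𝓘(ℝ, Model m) e.1.symm X z = chartField e X z := by
  have hleft := e.mdifferentiable.symm_comp_deriv (e.1.map_target hz)
  rw [e.1.right_inv hz] at hleft
  have hright := e.mdifferentiable.comp_symm_deriv hz
  rw [VectorField.mpullback_apply]
  exact DFunLike.congr_fun (ContinuousLinearMap.inverse_eq hleft hright) (X (e.1.symm z))

lemma chartField_lie (e : Chart m N) (X Y : SmoothField m N) {z : Model m}
    (hz : z ∈ e.1.target) :
    chartField e ⁅X, Y⁆ z = VectorField.lieBracket ℝ (chartField e X) (chartField e Y) z := by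
  have hn : minSmoothness ℝ 2 ≤ ∞ := by
    rw [minSmoothness_of_isRCLikeNormedField]
    exact two_le_infty
  have hsymm : ContMDiffAt 𝓘(ℝ, Model m) 𝓘(ℝ, Model m) ∞ e.1.symm z :=
    (contMDiffOn_symm_of_mem_maximalAtlas e.2).contMDiffAt (e.1.open_target.mem_nhds hz)
  have := IsManifold.of_le (I := 𝓘(ℝ, Model m)) (M := N) (m := minSmoothness ℝ 2) (n := ∞) hn
  have hpullback (Z : SmoothField m N) :
      VectorField.mpullback 𝓘(ℝ, Model m) 𝓘(ℝ, Model m) e.1.symm Z =ᶠ[𝓝 z] chartField e Z := by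
    filter_upwards [e.1.open_target.mem_nhds hz] with w hw
    exact mpullback_symm_eq_chartField e Z hw
  have hmodel (V W : ∀ w : Model m, TangentSpace 𝓘(ℝ, Model m) w) :
      VectorField.mlieBracket 𝓘(ℝ, Model m) V W z = VectorField.lieBracket ℝ V W z := by
    rw [← VectorField.mlieBracketWithin_univ, VectorField.mlieBracketWithin_eq_lieBracketWithin]
    exact congrFun VectorField.lieBracketWithin_univ z
  have hbracket := VectorField.mpullback_mlieBracket (X.mdifferentiableAt (e.1.symm z))
    (Y.mdifferentiableAt (e.1.symm z)) hsymm hn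
  have hcongr := (hpullback X).mlieBracket_vectorField_eq (hpullback Y)
  exact (mpullback_symm_eq_chartField e ⁅X, Y⁆ hz).symm.trans
    (hbracket.trans (hcongr.trans (hmodel _ _)))

lemma isIntegralCurveOn_chart_comp {e : Chart m N} {X : SmoothField m N} {γ : ℝ → N} {s : Set ℝ}
    (hγ : IsMIntegralCurveOn (I := 𝓘(ℝ, Model m)) γ X s) (hs : MapsTo γ s e.1.source) :
    IsIntegralCurveOn (fun t => e.1 (γ t)) (fun _ => chartField e X) s := by
  intro t ht
  have hcomp := (e.mdifferentiable.mdifferentiableAt (hs ht)).hasMFDerivAt.comp_hasMFDerivWithinAt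
    t (hγ t ht)
  refine hasDerivWithinAt_iff_hasFDerivWithinAt.2 (hcomp.hasFDerivWithinAt.congr_fderiv
    (ContinuousLinearMap.ext_ring ?_))
  change mfderiv 𝓘(ℝ, Model m) 𝓘(ℝ, Model m) e.1 (γ t) ((1 : ℝ) • X (γ t)) =
    (1 : ℝ) • chartField e X (e.1 (γ t))
  rw [one_smul, one_smul, chartField, e.1.left_inv (hs ht)]

lemma isMIntegralCurveOn_symm_comp {e : Chart m N} {X : SmoothField m N} {α : ℝ → Model m}
    {s : Set ℝ} (hα : IsIntegralCurveOn α (fun _ => chartField e X) s)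
    (hs : MapsTo α s e.1.target) :
    IsMIntegralCurveOn (I := 𝓘(ℝ, Model m)) (fun t => e.1.symm (α t)) X s := by
  intro t ht
  have hcomp := (e.mdifferentiable.mdifferentiableAt_symm
    (hs ht)).hasMFDerivAt.comp_hasMFDerivWithinAt t (hα t ht).hasFDerivWithinAt.hasMFDerivWithinAt
  refine hcomp.congr_mfderiv ?_
  refine ContinuousLinearMap.ext_ring ?_
  change mfderiv 𝓘(ℝ, Model m) 𝓘(ℝ, Model m) e.1.symm (α t) ((1 : ℝ) • chartField e X (α t)) =
    (1 : ℝ) • X (e.1.symm (α t))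
  rw [one_smul, one_smul, mfderiv_symm_chartField e X (hs ht)]

variable {X Y : SmoothField m N} {B : Set N}

lemma FlowPreserves.isLocallyInvariant (h : FlowPreserves X B) (e : Chart m N) {z : Model m}
    (hz : z ∈ e.1.target) : IsLocallyInvariant (chartImage B e) (chartField e X) z := by
  obtain ⟨Φ, hΦ⟩ := exists_isLocalFlowAt (contDiffAt_one_chartField e X hz)
  obtain ⟨δ, hδ, hflow⟩ := hΦ.exists_forall_mem_ball (e.1.open_target.eventually_mem hz)
  refine ⟨Φ, hΦ, ?_⟩
  filter_upwards [prod_mem_nhds (Metric.ball_mem_nhds z hδ)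
    (Ioo_mem_nhds (neg_neg_of_pos hδ) hδ)] with ⟨x, t⟩ ⟨hx, ht⟩ hxB
  obtain ⟨hzero, hcurve⟩ := hflow x hx
  refine ⟨(hcurve t ht).2, h (e.1.symm x) hxB.2 (fun s => e.1.symm (Φ (x, s))) (-δ) δ
    (neg_neg_of_pos hδ) hδ (congrArg e.1.symm hzero) ?_ t ht⟩
  exact isMIntegralCurveOn_symm_comp (fun s hs => (hcurve s hs).1.hasDerivWithinAt)
    fun s hs => (hcurve s hs).2

/-- The field `X` and its opposite `-X` both point into `B` along `B`, in the sense of contingent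
directions. On a closed set `B` this is the infinitesimal form of `FlowPreserves X B`. -/
def IsTangentTo (X : SmoothField m N) (B : Set N) : Prop :=
  ∀ e : Chart m N, ∀ z ∈ chartImage B e, chartField e X z ∈ tangentLines (chartImage B e) z

lemma FlowPreserves.isTangentTo (h : FlowPreserves X B) : IsTangentTo X B := fun e _ hz =>
  (h.isLocallyInvariant e hz.1).mem_tangentLines hz (contDiffAt_one_chartField e X hz.1)

lemma FlowPreserves.isTangentTo_add (hX : FlowPreserves X B) (hY : FlowPreserves Y B) :
    IsTangentTo (X + Y) B := fun e z hz => by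
  rw [chartField_add]
  exact (hX.isLocallyInvariant e hz.1).add_mem_tangentLines hz
    (contDiffAt_one_chartField e X hz.1) (contDiffAt_one_chartField e Y hz.1)
    (hY.isLocallyInvariant e hz.1)

lemma FlowPreserves.isTangentTo_lie (hX : FlowPreserves X B) (hY : FlowPreserves Y B) :
    IsTangentTo ⁅X, Y⁆ B := fun e z hz => by
  rw [chartField_lie e X Y hz.1]
  exact (hX.isLocallyInvariant e hz.1).lieBracket_mem_tangentLines hz
    (contDiffAt_one_chartField e X hz.1) (contDiffAt_one_chartField e Y hz.1)
    (hY.isLocallyInvariant e hz.1)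

lemma isTangentTo_zero : IsTangentTo (0 : SmoothField m N) B := fun e z hz => by
  rw [chartField_zero]
  exact zero_mem_tangentLines hz

lemma IsTangentTo.smul (h : IsTangentTo X B) (c : ℝ) : IsTangentTo (c • X) B := fun e z hz => by
  rw [chartField_smul]
  exact smul_mem_tangentLines c (h e z hz)

lemma IsTangentTo.eventually_mem (h : IsTangentTo X B) (hB : IsClosed B) {γ : ℝ → N} {a b : ℝ}
    (hab : a < b) (hγ : IsMIntegralCurveOn (I := 𝓘(ℝ, Model m)) γ X (Icc a b)) (ha : γ a ∈ B) :
    ∀ᶠ t in 𝓝[>] a, γ t ∈ B := by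
  let e : Chart m N := ⟨chartAt (Model m) (γ a), IsManifold.chart_mem_maximalAtlas (γ a)⟩
  have hsource : γ a ∈ e.1.source := mem_chart_source (Model m) (γ a)
  have hcont : ContinuousWithinAt γ (Ici a) a :=
    (hγ.continuousOn a (left_mem_Icc.2 hab.le)).mono_of_mem_nhdsWithin (Icc_mem_nhdsGE hab)
  obtain ⟨c, hac, hc⟩ := mem_nhdsGE_iff_exists_Icc_subset.1
    ((hcont.eventually (e.1.open_source.mem_nhds hsource)).and (Icc_mem_nhdsGE hab))
  obtain ⟨K, V, hV, hK⟩ :=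
    (contDiffAt_one_chartField e X (e.1.map_source hsource)).exists_lipschitzOnWith
  have hchart : ∀ᶠ t in 𝓝[>] a, e.1 (γ t) ∈ chartImage B e :=
    eventually_mem_of_forall_mem_posTangentConeAt (isLocallyClosed_chartImage hB e)
      ((apply_mem_chartImage_iff hsource).2 ha) hV hK
      (fun p hp => mem_posTangentConeAt_of_mem_tangentLines (h e p hp.1)) hac
      (isIntegralCurveOn_chart_comp (hγ.mono fun t ht => (hc ht).2) fun t ht => (hc ht).1) rfl
  filter_upwards [hchart, Ioc_mem_nhdsGT hac] with t ht htc
  exact (apply_mem_chartImage_iff (hc (Ioc_subset_Icc_self htc)).1).1 ht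

lemma IsTangentTo.mapsTo_Icc (h : IsTangentTo X B) (hB : IsClosed B) {γ : ℝ → N} {a b : ℝ}
    (hγ : IsMIntegralCurveOn (I := 𝓘(ℝ, Model m)) γ X (Icc a b)) (ha : γ a ∈ B) :
    MapsTo γ (Icc a b) B := by
  have hclosed : IsClosed (γ ⁻¹' B ∩ Icc a b) := by
    rw [inter_comm]
    exact hγ.continuousOn.preimage_isClosed_of_isClosed isClosed_Icc hB
  refine hclosed.Icc_subset_of_forall_mem_nhdsWithin ha fun t ht => ?_
  exact h.eventually_mem hB ht.2.2 (hγ.mono (Icc_subset_Icc_left ht.2.1)) ht.1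

lemma IsTangentTo.flowPreserves (h : IsTangentTo X B) (hB : IsClosed B) : FlowPreserves X B := by
  rintro _ hx γ a b ha hb rfl hγ t ht
  rcases le_total 0 t with h0 | h0
  · exact h.mapsTo_Icc hB (hγ.mono (Icc_subset_Ioo ha ht.2)) hx (right_mem_Icc.2 h0)
  · have hreverse : IsMIntegralCurveOn (I := 𝓘(ℝ, Model m)) (γ ∘ (· * (-1)))
        ((-1 : ℝ) • X : SmoothField m N) (Icc 0 (-t)) :=
      (hγ.comp_mul (-1)).mono fun s hs => by
        rw [mem_ofPred_eq, mul_neg_one]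
        exact ⟨ht.1.trans_le (le_neg.1 hs.2), (neg_nonpos.2 hs.1).trans_lt hb⟩
    simpa only [Function.comp, mul_neg_one, neg_neg] using
      (h.smul (-1)).mapsTo_Icc hB hreverse (by simpa only [Function.comp, zero_mul] using hx)
        (right_mem_Icc.2 (neg_nonneg.2 h0))

/-- The Lie algebra of the vector fields whose flow preserves a closed set. -/
def flowPreservingFields (hB : IsClosed B) : LieSubalgebra ℝ (SmoothField m N) where
  carrier := {X | FlowPreserves X B}
  add_mem' hX hY := (FlowPreserves.isTangentTo_add hX hY).flowPreserves hB
  zero_mem' := isTangentTo_zero.flowPreserves hB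
  smul_mem' c _ hX := ((FlowPreserves.isTangentTo hX).smul c).flowPreserves hB
  lie_mem' hX hY := (FlowPreserves.isTangentTo_lie hX hY).flowPreserves hB

end Tangency

section Whitney

variable {E F : Type*} [NormedAddCommGroup E] [NormedSpace ℝ E] [NormedAddCommGroup F]
  [NormedSpace ℝ F]

lemma continuous_whitneyTopology_apply {S : Set E} {z : E} (hz : z ∈ S) (k : ℕ) :
    Continuous[whitneyTopology S, inferInstance]
      (fun p : E → FormalMultilinearSeries ℝ E F => p z k) := by
  let _ : TopologicalSpace (E → FormalMultilinearSeries ℝ E F) := whitneyTopology S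
  set 𝒦 := {K : Set E | K ⊆ S ∧ IsCompact K}
  have hcomponent : Continuous fun p : E → FormalMultilinearSeries ℝ E F =>
      UniformOnFun.ofFun 𝒦 fun w => p w k :=
    continuous_iff_le_induced.2 (inf_le_left.trans (iInf_le _ k))
  exact (UniformOnFun.uniformContinuous_eval_of_mem (E [×k]→L[ℝ] F) 𝒦 (mem_singleton z)
    ⟨singleton_subset_iff.2 hz, isCompact_singleton⟩).continuous.comp hcomponent

end Whitney

namespace WhitneyPair

variable {m : ℕ} {N : Type*} [TopologicalSpace N] [ChartedSpace (Model m) N]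
  [IsManifold 𝓘(ℝ, Model m) ∞ N] (M : WhitneyPair m N)

/-- The restriction to `M` as a homomorphism of Lie algebras. -/
def restrictLieHom : SmoothField m N →ₗ⁅ℝ⁆ M.fields where
  __ := M.restrict
  map_lie' := M.restrict_lie _ _

/-- The value at a point of `M` of a vector field on `M`, read in a chart. -/
def evalChart (e : Chart m N) {z : Model m} (hz : z ∈ chartImage M.carrier e) :
    M.fields →ₗ[ℝ] Model m :=
  (mfderiv 𝓘(ℝ, Model m) 𝓘(ℝ, Model m) e.1 (e.1.symm z)).toLinearMap ∘ₗ
    LinearMap.proj (⟨e.1.symm z, hz.2⟩ : M.carrier) ∘ₗ M.fields.subtype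

lemma evalChart_restrict (e : Chart m N) {z : Model m} (hz : z ∈ chartImage M.carrier e)
    (X : SmoothField m N) : M.evalChart e hz (M.restrict X) = chartField e X z := rfl

lemma continuous_evalChart (e : Chart m N) {z : Model m} (hz : z ∈ chartImage M.carrier e) :
    Continuous[M.fieldTopology, inferInstance] (M.evalChart e hz) := by
  let _ := M.fieldTopology
  let _ : TopologicalSpace (Model m → FormalMultilinearSeries ℝ (Model m) (Model m)) :=
    whitneyTopology (chartImage M.carrier e)
  have hseries : Continuous fun Y : M.fields => chartFieldSeries e (extend Y) :=
    continuous_iff_le_induced.2 (iInf_le _ e)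
  have heval : ⇑(M.evalChart e hz) = fun Y => chartFieldSeries e (extend Y) z 0 ![] := by
    funext Y
    calc M.evalChart e hz Y = M.evalChart e hz (M.restrict (extend Y)) := by rw [restrict_extend]
      _ = chartField e (extend Y) z := M.evalChart_restrict e hz _
      _ = chartFieldSeries e (extend Y) z 0 ![] := (iteratedFDeriv_zero_apply _).symm
  rw [heval]
  exact (ContinuousMultilinearMap.apply ℝ (fun _ : Fin 0 => Model m) (Model m) ![]).continuous.comp
    ((continuous_whitneyTopology_apply hz 0).comp hseries)

lemma continuous_compactFieldTopology {F : Type*} [AddCommGroup F] [Module ℝ F]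
    [TopologicalSpace F] [IsTopologicalAddGroup F] [ContinuousSMul ℝ F] [LocallyConvexSpace ℝ F]
    {φ : M.fields →ₗ[ℝ] F} (hφ : Continuous[M.fieldTopology, inferInstance] φ) :
    Continuous[M.compactFieldTopology, inferInstance] fun Y : M.compactFields => φ Y := by
  let ψ : M.compactFields →ₗ[ℝ] F := φ ∘ₗ M.compactFields.toSubmodule.subtype
  refine continuous_iff_le_induced.2 (sInf_le ⟨topologicalAddGroup_induced ψ,
    continuousSMul_induced ψ, LocallyConvexSpace.induced ψ, fun K _ _ => ?_⟩)
  let _ := M.fieldTopology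
  let _ : TopologicalSpace {X : M.compactFields // M.supp X.1 ⊆ K} :=
    TopologicalSpace.induced (fun X => X.1.1) M.fieldTopology
  exact continuous_induced_rng.2 (hφ.comp continuous_induced_dom)

variable {B : Set N}

lemma exists_restrict_eq_flowPreserves_iff (hB : IsClosed B) (hBM : B ⊆ M.carrier) {Y : M.fields} :
    (∃ X, M.restrict X = Y ∧ FlowPreserves X B) ↔
      ∀ e : Chart m N, ∀ z (hz : z ∈ chartImage B e),
        M.evalChart e ⟨hz.1, hBM hz.2⟩ Y ∈ tangentLines (chartImage B e) z := by
  constructor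
  · rintro ⟨X, rfl, hX⟩
    exact hX.isTangentTo
  · intro h
    rw [← restrict_extend Y] at h
    exact ⟨extend Y, restrict_extend Y, IsTangentTo.flowPreserves h hB⟩

lemma isClosed_setOf_exists_flowPreserves (hB : IsClosed B) (hBM : B ⊆ M.carrier) {T : Type*}
    [TopologicalSpace T] {ι : T → M.fields}
    (hι : ∀ (e : Chart m N) (z) (hz : z ∈ chartImage M.carrier e),
      Continuous fun Y => M.evalChart e hz (ι Y)) :
    IsClosed {Y : T | ∃ X, M.restrict X = ι Y ∧ FlowPreserves X B} := by
  simp only [M.exists_restrict_eq_flowPreserves_iff hB hBM, ofPred_forall]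
  exact isClosed_iInter fun e => isClosed_iInter fun z => isClosed_iInter fun _ =>
    (isClosed_tangentLines _ z).preimage (hι e z _)

end WhitneyPair

end WhitneyGerm

end

theorem mainTheorem12_general {m : ℕ} {N : Type*} [TopologicalSpace N]
    [ChartedSpace (WhitneyGerm.Model m) N] [IsManifold 𝓘(ℝ, WhitneyGerm.Model m) ∞ N]
    (M : WhitneyGerm.WhitneyPair m N) {B : Set N} (hB : IsClosed B) (hBM : B ⊆ M.carrier) :
    (∃ L : LieSubalgebra ℝ M.fields,
      (L : Set M.fields) = {Y | ∃ X, M.restrict X = Y ∧ WhitneyGerm.FlowPreserves X B} ∧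
      IsClosed[M.fieldTopology] (L : Set M.fields)) ∧
    (∃ L : LieSubalgebra ℝ M.compactFields,
      (L : Set M.compactFields) =
        {Y : M.compactFields | ∃ X, M.restrict X = Y ∧ WhitneyGerm.FlowPreserves X B} ∧
      IsClosed[M.compactFieldTopology] (L : Set M.compactFields)) := by
  let L := (WhitneyGerm.flowPreservingFields hB).map M.restrictLieHom
  have hL : (L : Set M.fields) = {Y | ∃ X, M.restrict X = Y ∧ WhitneyGerm.FlowPreserves X B} :=
    Set.ext fun _ => exists_congr fun _ => and_comm
  have hLc : (L.comap M.compactFields.incl : Set M.compactFields) =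
      {Y : M.compactFields | ∃ X, M.restrict X = Y ∧ WhitneyGerm.FlowPreserves X B} :=
    congrArg (Subtype.val ⁻¹' ·) hL
  refine ⟨⟨L, hL, ?_⟩, L.comap M.compactFields.incl, hLc, ?_⟩
  · let _ := M.fieldTopology
    rw [hL]
    exact M.isClosed_setOf_exists_flowPreserves hB hBM fun e _ hz => M.continuous_evalChart e hz
  · let _ := M.compactFieldTopology
    rw [hLc]
    exact M.isClosed_setOf_exists_flowPreserves hB hBM fun e _ hz =>
      M.continuous_compactFieldTopology (M.continuous_evalChart e hz)

theorem mainTheorem12 (m : ℕ) (N : Type*) [TopologicalSpace N] [T2Space N]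
    [SecondCountableTopology N] [ConnectedSpace N]
    [ChartedSpace (WhitneyGerm.Model m) N]
    [IsManifold 𝓘(ℝ, WhitneyGerm.Model m) ∞ N]
    (M : WhitneyGerm.WhitneyPair m N) :
    (∃ L : LieSubalgebra ℝ M.fields,
      (L : Set M.fields) = M.boundaryFields ∧
      IsClosed[M.fieldTopology] (L : Set M.fields)) ∧
    (∃ L : LieSubalgebra ℝ M.compactFields,
      (L : Set M.compactFields) = M.compactBoundaryFields ∧
      IsClosed[M.compactFieldTopology] (L : Set M.compactFields)) :=
  mainTheorem12_general M isClosed_frontier M.isClosed.frontier_subset
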